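/- Let $0<\ell\le 1$, $T>0$, $H=L^2(0,\ell)$ (real-valued), $u_0\in H$ with $u_0\neq 0$, and $\alpha_1,\alpha_2\in[0,2)$. For $\alpha\in[0,2)$ let $H^1_\alpha(0,\ell)$ be the space of $f\in H$ having a weak derivative $\partial_x f\in L^1_{loc}(0,\ell)$ with $\int_0^\ell x^\alpha|\partial_x f|^2\,dx<\infty$ and $f(\ell)=0$, and in addition $f(0)=0$ if $\alpha<1$; let $H^2_\alpha(0,\ell)=\{f\in H^1_\alpha(0,\ell): x^\alpha\partial_x f\in H^1(0,\ell)\}$. For $i=1,2$ let $u_i\in C([0,T];H)$ be a solution of $$\partial_t u_i-\partial_x\big(x^{\alpha_i}\partial_x u_i\big)=0\ \text{ in }(0,\ell)\times(0,T),\qquad u_i(\ell,t)=0,\qquad u_i(\cdot,0)=u_0,$$ with the further boundary condition $u_i(0,t)=0$ if $0\le\alpha_i<1$ (weak degeneracy), and $x^{\alpha_i}\partial_x u_i(x,t)|_{x=0}=0$ if $1\le\alpha_i<2$ (strong degeneracy); that is, $u_i(0)=u_0$ and, for every $t\in(0,T]$, $u_i(t)\in H^2_{\alpha_i}(0,\ell)$,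 the boundary conditions hold, and $u_i:[0,T]\to H$ is differentiable at $t$ (one-sidedly at $t=T$) with $u_i'(t)=\partial_x(x^{\alpha_i}\partial_x u_i(t))$. Suppose that for some $t_0\in(0,T]$ $$\partial_t u_1(\cdot,t_0)=\partial_t u_2(\cdot,t_0)\quad\text{and}\quad \partial_x u_1(\cdot,t_0)=\partial_x u_2(\cdot,t_0)\quad\text{a.e. in }(0,\ell).$$ Then $\alpha_1=\alpha_2$. -/

import Mathlib

open MeasureTheory Set Filter Topology

namespace DegenerateParabolic

/-- Lebesgue measure on the interval `(0, ℓ)`. -/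
noncomputable abbrev mu (ℓ : ℝ) : Measure ℝ := volume.restrict (Ioo 0 ℓ)

/-- The Hilbert space `H = L²(0, ℓ)` of real square integrable functions. -/
abbrev H (ℓ : ℝ) : Type := Lp ℝ 2 (mu ℓ)

/-- `v` is the derivative of `f` on `(0, ℓ)` in the sense of distributions, in its one-dimensional
form: `v ∈ L¹_loc(0, ℓ)` and `f` agrees almost everywhere on `(0, ℓ)` with a function that is
locally absolutely continuous there with derivative `v`. -/
def HasWeakDeriv (ℓ : ℝ) (f v : ℝ → ℝ) : Prop :=
  LocallyIntegrableOn v (Ioo 0 ℓ) ∧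
    ∃ w : ℝ → ℝ, f =ᵐ[mu ℓ] w ∧
      ∀ x ∈ Ioo 0 ℓ, ∀ y ∈ Ioo 0 ℓ, w y - w x = ∫ s in x..y, v s

/-- The continuous representative of `f` on `(0, ℓ)` tends to `c` along the filter `F`. It is used
with `F = 𝓝[>] 0` (trace at `0`) and `F = 𝓝[<] ℓ` (trace at `ℓ`). -/
def HasTrace (ℓ : ℝ) (f : ℝ → ℝ) (F : Filter ℝ) (c : ℝ) : Prop :=
  ∃ w : ℝ → ℝ, f =ᵐ[mu ℓ] w ∧ ContinuousOn w (Ioo 0 ℓ) ∧ Tendsto w F (𝓝 c)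

/-- The Sobolev space `H¹(0, ℓ)`. -/
def MemH1 (ℓ : ℝ) (f : ℝ → ℝ) : Prop :=
  MemLp f 2 (mu ℓ) ∧ ∃ v : ℝ → ℝ, HasWeakDeriv ℓ f v ∧ MemLp v 2 (mu ℓ)

/-- The weighted space `H¹_α(0, ℓ)`: functions `f ∈ L²(0, ℓ)` with `∫ x^α |∂ₓ f|² < ∞` and
`f(ℓ) = 0`, and moreover `f(0) = 0` when `α < 1`. -/
structure MemH1Weighted (α ℓ : ℝ) (f : ℝ → ℝ) : Prop where
  memLp : MemLp f 2 (mu ℓ)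
  energy : ∃ v : ℝ → ℝ, HasWeakDeriv ℓ f v ∧ IntegrableOn (fun x => x ^ α * v x ^ 2) (Ioo 0 ℓ)
  right : HasTrace ℓ f (𝓝[<] ℓ) 0
  left : α < 1 → HasTrace ℓ f (𝓝[>] 0) 0

/-- The weighted space `H²_α(0, ℓ)`: functions `f ∈ H¹_α(0, ℓ)` with `x^α ∂ₓ f ∈ H¹(0, ℓ)`. -/
def MemH2Weighted (α ℓ : ℝ) (f : ℝ → ℝ) : Prop :=
  MemH1Weighted α ℓ f ∧
    ∃ v : ℝ → ℝ, HasWeakDeriv ℓ f v ∧ MemH1 ℓ (fun x => x ^ α * v x)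

/-- `u : [0, T] → L²(0, ℓ)` solves `∂ₜ u - ∂ₓ(x^α ∂ₓ u) = 0` in `(0, ℓ) × (0, T)` with initial
value `u₀`, with `u(ℓ, t) = 0`, and with `u(0, t) = 0` if `α < 1` (weak degeneracy) or
`x^α ∂ₓ u(x, t) → 0` as `x → 0` if `1 ≤ α` (strong degeneracy). This is the classical solution of
the Cauchy problem `u' = A u`, `u(0) = u₀` in `L²(0, ℓ)`, where `A f = ∂ₓ(x^α ∂ₓ f)` has the domain
`H²_α(0, ℓ)`. The conditions `u(ℓ, t) = 0` and, for `α < 1`, `u(0, t) = 0` are part of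
`u(t) ∈ H²_α(0, ℓ)`. -/
structure IsSolution (α ℓ T : ℝ) (u₀ : H ℓ) (u : ℝ → H ℓ) : Prop where
  cont : ContinuousOn u (Icc 0 T)
  init : u 0 = u₀
  regular : ∀ t ∈ Ioc 0 T, MemH2Weighted α ℓ (u t)
  neumann : 1 ≤ α → ∀ t ∈ Ioc 0 T, ∀ v : ℝ → ℝ, HasWeakDeriv ℓ (u t) v →
    HasTrace ℓ (fun x => x ^ α * v x) (𝓝[>] 0) 0
  equation : ∀ t ∈ Ioc 0 T, ∃ ut : H ℓ, HasDerivWithinAt u ut (Icc 0 T) t ∧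
    ∃ v : ℝ → ℝ, HasWeakDeriv ℓ (u t) v ∧ HasWeakDeriv ℓ (fun x => x ^ α * v x) ut

end DegenerateParabolic

/-! At `t₀` the two solutions share their space derivative and both vanish at `ℓ`, so they are the
same function `f`; their time derivatives give a common image `g` under both operators. Pairing `g`
with `f` and integrating by parts yields `∫ x^α₁ |∂ₓf|² = ∫ x^α₂ |∂ₓf|²`. Since `0 < x < 1` on the
interval, the weights are strictly ordered when `α₁ ≠ α₂`, hence `∂ₓf = 0` and `f = 0`
(`IsGeneratorPair.eq_zero_of_lt`). Backward uniqueness, a consequence of the symmetry of the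
operator (`eq_zero_of_symmetric_flow`), then forces `u₀ = 0`.

The delicate point is the boundary term at the degenerate end `x = 0` in the integration by parts
(`IsPrimitiveOn.integral_mul_eq_neg`). -/

namespace DegenerateParabolic

/-! ### Locally absolutely continuous functions on `(0, ℓ)`. -/

/-- `w` is a primitive of the locally integrable function `v` on `(0, ℓ)`. -/
def IsPrimitiveOn (ℓ : ℝ) (w v : ℝ → ℝ) : Prop :=
  LocallyIntegrableOn v (Ioo 0 ℓ) ∧
    ∀ x ∈ Ioo 0 ℓ, ∀ y ∈ Ioo 0 ℓ, w y - w x = ∫ s in x..y, v s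

variable {ℓ : ℝ} {w v p q : ℝ → ℝ}

lemma uIcc_subset_Ioo {a b : ℝ} (ha : a ∈ Ioo 0 ℓ) (hb : b ∈ Ioo 0 ℓ) : uIcc a b ⊆ Ioo 0 ℓ :=
  ordConnected_Ioo.uIcc_subset ha hb

namespace IsPrimitiveOn

lemma intervalIntegrable (h : IsPrimitiveOn ℓ w v) {a b : ℝ} (ha : a ∈ Ioo 0 ℓ)
    (hb : b ∈ Ioo 0 ℓ) : IntervalIntegrable v volume a b :=
  (h.1.integrableOn_compact_subset (uIcc_subset_Ioo ha hb) isCompact_uIcc).intervalIntegrable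

lemma continuousOn_uIcc (h : IsPrimitiveOn ℓ w v) {a b : ℝ} (ha : a ∈ Ioo 0 ℓ)
    (hb : b ∈ Ioo 0 ℓ) : ContinuousOn w (uIcc a b) := by
  have hc := (h.intervalIntegrable ha hb).absolutelyContinuousOnInterval_intervalIntegral
    (c := a) (by simp)
  refine (hc.continuousOn.const_add (w a)).congr fun x hx => ?_
  have := h.2 a ha x (uIcc_subset_Ioo ha hb hx)
  simp only
  linarith

lemma continuousOn (h : IsPrimitiveOn ℓ w v) : ContinuousOn w (Ioo 0 ℓ) := by
  intro x hx
  have ha : x / 2 ∈ Ioo 0 ℓ := ⟨by linarith [hx.1], by linarith [hx.1, hx.2]⟩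
  have hb : (x + ℓ) / 2 ∈ Ioo 0 ℓ := ⟨by linarith [hx.1, hx.2], by linarith [hx.2]⟩
  refine ((h.continuousOn_uIcc ha hb).continuousAt ?_).continuousWithinAt
  rw [uIcc_of_le (by linarith [hx.1, hx.2])]
  exact Icc_mem_nhds (by linarith [hx.1]) (by linarith [hx.2])

/-- Since `v` is only locally integrable, Lebesgue differentiation is applied on countably many
compact intervals exhausting `(0, ℓ)`. -/
lemma ae_hasDerivAt (h : IsPrimitiveOn ℓ w v) : ∀ᵐ x ∂mu ℓ, HasDerivAt w (v x) x := by
  rcases le_or_gt ℓ 0 with hℓ | hℓ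
  · simp [mu, Ioo_eq_empty (not_lt.2 hℓ)]
  obtain ⟨a, ha1, ha2, ha⟩ := exists_seq_strictAnti_tendsto' hℓ
  obtain ⟨b, hb1, hb2, hb⟩ := exists_seq_strictMono_tendsto' hℓ
  have hall : ∀ᵐ x, ∀ n, x ∈ uIcc (a n) (b n) →
      ∀ c ∈ uIcc (a n) (b n), HasDerivAt (fun y => ∫ t in c..y, v t) (v x) x :=
    ae_all_iff.2 fun n => (h.intervalIntegrable (ha2 n) (hb2 n)).ae_hasDerivAt_integral
  filter_upwards [(aecover_Ioo_of_Icc (μ := volume) ha hb).ae_eventually_mem,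
    ae_restrict_of_ae hall, ae_restrict_mem measurableSet_Ioo] with x hx hd hxI
  obtain ⟨n, hn⟩ := hx.exists
  have hsub : Icc (a n) (b n) ⊆ uIcc (a n) (b n) := Icc_subset_uIcc
  have := (hd n (hsub hn) (a n) left_mem_uIcc).const_add (w (a n))
  refine this.congr_of_eventuallyEq ?_
  filter_upwards [isOpen_Ioo.mem_nhds hxI] with y hy
  have := h.2 _ (ha2 n) y hy
  linarith

lemma mul (hp : IsPrimitiveOn ℓ p q) (hw : IsPrimitiveOn ℓ w v) :
    IsPrimitiveOn ℓ (fun x => p x * w x) (fun x => q x * w x + p x * v x) := by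
  refine ⟨?_, fun a ha b hb => ?_⟩
  · refine LocallyIntegrableOn.add ?_ ?_
    · exact hp.1.mul_continuousOn hw.continuousOn isOpen_Ioo.isLocallyClosed
    · exact hw.1.continuousOn_mul hp.continuousOn isOpen_Ioo.isLocallyClosed
  · have hP := (hp.intervalIntegrable ha hb).absolutelyContinuousOnInterval_intervalIntegral
      (c := a) (by simp)
    have hW := (hw.intervalIntegrable ha hb).absolutelyContinuousOnInterval_intervalIntegral
      (c := a) (by simp)
    have hc : ∀ c : ℝ, AbsolutelyContinuousOnInterval (fun _ => c) a b := fun c =>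
      (LipschitzWith.const c).lipschitzOnWith.absolutelyContinuousOnInterval
    have key := ((hc (p a)).add hP).integral_deriv_mul_eq_sub ((hc (w a)).add hW)
    have eP : ∀ x ∈ uIcc a b, p a + ∫ t in a..x, q t = p x := fun x hx => by
      linarith [hp.2 a ha x (uIcc_subset_Ioo ha hb hx)]
    have eW : ∀ x ∈ uIcc a b, w a + ∫ t in a..x, v t = w x := fun x hx => by
      linarith [hw.2 a ha x (uIcc_subset_Ioo ha hb hx)]
    simp only [Pi.add_apply] at key
    rw [eP b right_mem_uIcc, eW b right_mem_uIcc, eP a left_mem_uIcc, eW a left_mem_uIcc] at key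
    rw [← key]
    refine intervalIntegral.integral_congr_ae ?_
    filter_upwards [(hp.intervalIntegrable ha hb).ae_hasDerivAt_integral,
      (hw.intervalIntegrable ha hb).ae_hasDerivAt_integral] with x h1 h2 hx
    have hx' := uIoc_subset_uIcc hx
    have d1 := ((h1 hx' a left_mem_uIcc).const_add (p a)).deriv
    have d2 := ((h2 hx' a left_mem_uIcc).const_add (w a)).deriv
    rw [eP x hx', eW x hx']
    erw [d1, d2]

/-- Two locally absolutely continuous functions that agree a.e. have the same derivative. -/
lemma ae_eq {w' v' : ℝ → ℝ} (h : IsPrimitiveOn ℓ w v) (h' : IsPrimitiveOn ℓ w' v')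
    (hw : w =ᵐ[mu ℓ] w') : v =ᵐ[mu ℓ] v' := by
  have heq : EqOn w w' (Ioo 0 ℓ) :=
    Measure.eqOn_open_of_ae_eq hw isOpen_Ioo h.continuousOn h'.continuousOn
  filter_upwards [h.ae_hasDerivAt, h'.ae_hasDerivAt, ae_restrict_mem measurableSet_Ioo]
    with x h1 h2 hx
  exact h1.unique (h2.congr_of_eventuallyEq (heq.eventuallyEq_of_mem (isOpen_Ioo.mem_nhds hx)))

lemma tendsto_of_hasTrace (h : IsPrimitiveOn ℓ w v) {f : ℝ → ℝ} (hf : f =ᵐ[mu ℓ] w)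
    {F : Filter ℝ} (hF : Ioo 0 ℓ ∈ F) {c : ℝ} (ht : HasTrace ℓ f F c) : Tendsto w F (𝓝 c) := by
  obtain ⟨w', hw', hc, hlim⟩ := ht
  have heq : EqOn w' w (Ioo 0 ℓ) :=
    Measure.eqOn_open_of_ae_eq (hw'.symm.trans hf) isOpen_Ioo hc h.continuousOn
  exact hlim.congr' (heq.eventuallyEq_of_mem hF)

/-- A primitive of an integrable function extends continuously to the closed interval. -/
lemma exists_extension (hℓ : 0 < ℓ) (h : IsPrimitiveOn ℓ w v)
    (hv : IntegrableOn v (Ioo 0 ℓ)) :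
    ∃ W : ℝ → ℝ, EqOn w W (Ioo 0 ℓ) ∧ Tendsto w (𝓝[>] 0) (𝓝 (W 0)) ∧
      Tendsto w (𝓝[<] ℓ) (𝓝 (W ℓ)) ∧
      ∀ x ∈ Icc 0 ℓ, W x - W 0 = ∫ s in 0..x, v s := by
  have hi : IntervalIntegrable v volume 0 ℓ :=
    (intervalIntegrable_iff_integrableOn_Ioo_of_le hℓ.le).2 hv
  have hm : ℓ / 2 ∈ Ioo 0 ℓ := ⟨by linarith, by linarith⟩
  have hm' : ℓ / 2 ∈ Icc 0 ℓ := Ioo_subset_Icc_self hm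
  have hi' : ∀ x ∈ Icc 0 ℓ, ∀ y ∈ Icc 0 ℓ, IntervalIntegrable v volume x y := fun x hx y hy =>
    hi.mono_set (by rw [uIcc_of_le hℓ.le]; exact ordConnected_Icc.uIcc_subset hx hy)
  have hc : ContinuousOn (fun x => w (ℓ / 2) + ∫ s in (ℓ / 2)..x, v s) (Icc 0 ℓ) := by
    have := (hi.absolutelyContinuousOnInterval_intervalIntegral (c := ℓ / 2)
      (by rwa [uIcc_of_le hℓ.le])).continuousOn
    rw [uIcc_of_le hℓ.le] at this
    exact this.const_add _
  have heq : EqOn w (fun x => w (ℓ / 2) + ∫ s in (ℓ / 2)..x, v s) (Ioo 0 ℓ) := fun x hx => by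
    have := h.2 _ hm x hx
    simp only
    linarith
  refine ⟨_, heq, ?_, ?_, fun x hx => ?_⟩
  · have := (hc 0 (left_mem_Icc.2 hℓ.le)).mono_left
      (nhdsWithin_mono 0 (Ioo_subset_Icc_self (a := (0 : ℝ)) (b := ℓ)))
    rw [nhdsWithin_Ioo_eq_nhdsGT hℓ] at this
    exact this.congr' (heq.symm.eventuallyEq_of_mem (Ioo_mem_nhdsGT hℓ))
  · have := (hc ℓ (right_mem_Icc.2 hℓ.le)).mono_left
      (nhdsWithin_mono ℓ (Ioo_subset_Icc_self (a := (0 : ℝ)) (b := ℓ)))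
    rw [nhdsWithin_Ioo_eq_nhdsLT hℓ] at this
    exact this.congr' (heq.symm.eventuallyEq_of_mem (Ioo_mem_nhdsLT hℓ))
  · have h0 : (0 : ℝ) ∈ Icc 0 ℓ := left_mem_Icc.2 hℓ.le
    have := intervalIntegral.integral_add_adjacent_intervals (hi' 0 h0 _ hm') (hi' _ hm' x hx)
    have h2 := intervalIntegral.integral_symm (f := v) (μ := volume) (ℓ / 2) 0
    linarith

/-! ### Behaviour at the degenerate end and Green's formula. -/

/-- If `p` vanishes at `0` and has a square integrable derivative, `|p x| ≤ C √x`. -/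
lemma sq_le_mul (hℓ : 0 < ℓ) (hp : IsPrimitiveOn ℓ p q) (hq : MemLp q 2 (mu ℓ))
    (h0 : Tendsto p (𝓝[>] 0) (𝓝 0)) : ∃ K, ∀ x ∈ Ioo 0 ℓ, p x ^ 2 ≤ K * x := by
  have hq1 : IntegrableOn q (Ioo 0 ℓ) := hq.integrable (by norm_num)
  have hq2 : IntegrableOn (fun x => q x ^ 2) (Ioo 0 ℓ) := hq.integrable_sq
  obtain ⟨W, hW, hW0, -, hWi⟩ := hp.exists_extension hℓ hq1
  have e0 : W 0 = 0 := tendsto_nhds_unique hW0 h0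
  refine ⟨((1 + ∫ x in Ioo 0 ℓ, q x ^ 2) / 2) ^ 2, fun x hx => ?_⟩
  have hs : 0 < √x := Real.sqrt_pos.2 hx.1
  have hsx : √x * √x = x := Real.mul_self_sqrt hx.1.le
  have hsub : Ioo 0 x ⊆ Ioo 0 ℓ := Ioo_subset_Ioo_right hx.2.le
  have hpx : p x = ∫ s in Ioo 0 x, q s := by
    rw [hW hx, ← integral_Ioc_eq_integral_Ioo, ← intervalIntegral.integral_of_le hx.1.le,
      ← hWi x (Ioo_subset_Icc_self hx), e0, sub_zero]
  -- Young's inequality replaces Cauchy–Schwarz; the weight `√x` makes both terms integrate over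
  -- `(0, x)` to `O(√x)`.
  have hb : |p x| ≤ ∫ s in Ioo 0 x, ((√x)⁻¹ / 2 + √x / 2 * q s ^ 2) := by
    rw [hpx]
    refine (abs_integral_le_integral_abs).trans (integral_mono (hq1.mono_set hsub).abs ?_ ?_)
    · exact (integrable_const _).add ((hq2.mono_set hsub).const_mul _)
    · intro s
      have : 0 ≤ (√x)⁻¹ * (1 - √x * |q s|) ^ 2 := by positivity
      have e : (√x)⁻¹ * (1 - √x * |q s|) ^ 2 = (√x)⁻¹ - 2 * |q s| + √x * q s ^ 2 := by
        rw [← sq_abs (q s)]; field_simp; ring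
      simp only
      linarith
  have hb2 : ∫ s in Ioo 0 x, ((√x)⁻¹ / 2 + √x / 2 * q s ^ 2) ≤
      √x * ((1 + ∫ x in Ioo 0 ℓ, q x ^ 2) / 2) := by
    rw [integral_add (integrable_const _) ((hq2.mono_set hsub).const_mul _), integral_const_mul]
    have hm : ∫ s in Ioo 0 x, q s ^ 2 ≤ ∫ s in Ioo 0 ℓ, q s ^ 2 :=
      setIntegral_mono_set hq2 (Eventually.of_forall fun s => sq_nonneg _)
        hsub.eventuallyLE
    have e : ∫ _ in Ioo 0 x, (√x)⁻¹ / 2 = √x / 2 := by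
      simp only [integral_const, MeasurableSet.univ, measureReal_restrict_apply, univ_inter,
        Real.volume_real_Ioo_of_le hx.1.le, smul_eq_mul, sub_zero]
      field_simp
      linarith
    rw [e]
    nlinarith
  have := pow_le_pow_left₀ (abs_nonneg _) (hb.trans hb2) 2
  rw [sq_abs, mul_pow, Real.sq_sqrt hx.1.le] at this
  linarith

/-- Green's formula `∫ p' w = - ∫ p w'` when `w` vanishes at `ℓ` and either `w` or `p` vanishes
at `0`. -/
lemma integral_mul_eq_neg (hℓ : 0 < ℓ) (hp : IsPrimitiveOn ℓ p q) (hw : IsPrimitiveOn ℓ w v)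
    (hq : MemLp q 2 (mu ℓ)) (hw2 : MemLp w 2 (mu ℓ))
    (hpv : Integrable (fun x => p x * v x) (mu ℓ)) (hwℓ : Tendsto w (𝓝[<] ℓ) (𝓝 0))
    (h0 : Tendsto w (𝓝[>] 0) (𝓝 0) ∨ Tendsto p (𝓝[>] 0) (𝓝 0)) :
    ∫ x, q x * w x ∂mu ℓ = - ∫ x, p x * v x ∂mu ℓ := by
  have hqw : Integrable (fun x => q x * w x) (mu ℓ) := hq.integrable_mul hw2
  obtain ⟨P, -, hP0, hPℓ, -⟩ := hp.exists_extension hℓ (hq.integrable (by norm_num))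
  -- `p w` has limits at both ends because its derivative is integrable, although `w` alone may be
  -- unbounded at `0`.
  obtain ⟨N, -, hN0, hNℓ, hN⟩ := (hp.mul hw).exists_extension hℓ (hqw.add hpv)
  have eℓ : N ℓ = 0 := tendsto_nhds_unique hNℓ (by simpa using hPℓ.mul hwℓ)
  have e0 : N 0 = 0 := by
    rcases h0 with h0 | h0
    · exact tendsto_nhds_unique hN0 (by simpa using hP0.mul h0)
    -- A nonzero limit of `p w` together with `p² ≤ K x` would give `w² ≥ c / x` near `0`; then `1 /
    -- x` would be integrable there, as `w` is in `L²`.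
    · by_contra hne
      obtain ⟨K, hK⟩ := hp.sq_le_mul hℓ hq h0
      have hpos : 0 < N 0 ^ 2 := by positivity
      have hev := ((hN0.pow 2).eventually_const_lt (half_lt_self hpos)).and (Ioo_mem_nhdsGT hℓ)
      obtain ⟨δ, hδ, hδs⟩ := mem_nhdsGT_iff_exists_Ioo_subset.1 hev
      have hδ0 : (0 : ℝ) < δ := hδ
      have hδℓ : Ioo 0 δ ⊆ Ioo 0 ℓ := fun x hx => (hδs hx).2
      have hint : IntegrableOn (fun x => (2 * K / N 0 ^ 2) * w x ^ 2) (Ioo 0 δ) :=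
        ((show IntegrableOn (fun x => w x ^ 2) (Ioo 0 ℓ) volume from hw2.integrable_sq).mono_set
          hδℓ).const_mul _
      have hinv : IntegrableOn (fun x : ℝ => x⁻¹) (Ioo 0 δ) := by
        refine Integrable.mono' hint (measurable_inv.aestronglyMeasurable) ?_
        filter_upwards [ae_restrict_mem measurableSet_Ioo] with x hx
        have h1 : N 0 ^ 2 / 2 < (p x * w x) ^ 2 := (hδs hx).1
        have h2 := mul_le_mul_of_nonneg_right (hK x (hδℓ hx)) (sq_nonneg (w x))
        rw [Real.norm_of_nonneg (inv_nonneg.2 hx.1.le), inv_le_iff_one_le_mul₀ hx.1,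
          show 2 * K / N 0 ^ 2 * w x ^ 2 * x = (2 * K * x * w x ^ 2) / N 0 ^ 2 by ring,
          one_le_div hpos]
        linarith [mul_pow (p x) (w x) 2]
      rw [← intervalIntegrable_iff_integrableOn_Ioo_of_le hδ0.le, intervalIntegrable_inv_iff]
        at hinv
      rcases hinv with h | h
      · exact hδ0.ne h
      · exact h left_mem_uIcc
  have := hN ℓ (right_mem_Icc.2 hℓ.le)
  rw [eℓ, e0, sub_zero, intervalIntegral.integral_of_le hℓ.le, integral_Ioc_eq_integral_Ioo,
    integral_add hqw hpv] at this
  linarith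

end IsPrimitiveOn

/-! ### The degenerate operator and its quadratic form. -/

/-- `f` belongs to the domain of `A = ∂ₓ(x^α ∂ₓ ·)` with its boundary conditions and `A f = g`;
`w` and `p` are the continuous representatives of `f` and of `x^α ∂ₓ f`, and `v = ∂ₓ f`. -/
structure IsGeneratorPair (α ℓ : ℝ) (f g : H ℓ) (w v p : ℝ → ℝ) : Prop where
  ae_eq : f =ᵐ[mu ℓ] w
  primitive : IsPrimitiveOn ℓ w v
  flux_ae_eq : (fun x => x ^ α * v x) =ᵐ[mu ℓ] p
  flux_primitive : IsPrimitiveOn ℓ p g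
  energy : Integrable (fun x => x ^ α * v x ^ 2) (mu ℓ)
  right : Tendsto w (𝓝[<] ℓ) (𝓝 0)
  left : α < 1 → Tendsto w (𝓝[>] 0) (𝓝 0)
  flux_left : 1 ≤ α → Tendsto p (𝓝[>] 0) (𝓝 0)

/-- The energy bound and the equation may each supply their own weak derivative; these agree a.e.,
so a single `v` serves for all conditions. -/
lemma IsSolution.exists_isGeneratorPair {α ℓ T : ℝ} (hℓ : 0 < ℓ) {u₀ : H ℓ} {u : ℝ → H ℓ}
    (h : IsSolution α ℓ T u₀ u) {t : ℝ} (ht : t ∈ Ioc 0 T) :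
    ∃ g, HasDerivWithinAt u g (Icc 0 T) t ∧ ∃ w v p, IsGeneratorPair α ℓ (u t) g w v p := by
  obtain ⟨g, hg, v, hv, hflux⟩ := h.equation t ht
  obtain ⟨⟨-, ⟨v', hv', henergy⟩, hright, hleft⟩, -⟩ := h.regular t ht
  have hneu := fun hα => h.neumann hα t ht v hv
  obtain ⟨hvi, w, hfw, hw⟩ := hv
  obtain ⟨hvi', w', hfw', hw'⟩ := hv'
  obtain ⟨hgi, p, hp, hpg⟩ := hflux
  have hwv : IsPrimitiveOn ℓ w v := ⟨hvi, hw⟩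
  have hpq : IsPrimitiveOn ℓ p g := ⟨hgi, hpg⟩
  have hvv : v' =ᵐ[mu ℓ] v :=
    IsPrimitiveOn.ae_eq (w := w') (w' := w) ⟨hvi', hw'⟩ hwv (hfw'.symm.trans hfw)
  refine ⟨g, hg, w, v, p, hfw, hwv, hp, hpq, ?_, ?_, ?_, ?_⟩
  · refine Integrable.congr henergy ?_
    filter_upwards [hvv] with x hx
    rw [hx]
  · exact hwv.tendsto_of_hasTrace hfw (Ioo_mem_nhdsLT hℓ) hright
  · exact fun hα => hwv.tendsto_of_hasTrace hfw (Ioo_mem_nhdsGT hℓ) (hleft hα)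
  · exact fun hα => hpq.tendsto_of_hasTrace hp (Ioo_mem_nhdsGT hℓ) (hneu hα)

/-- The weak form `⟨A f, f'⟩ = - ∫ x^α ∂ₓf ∂ₓf'`. -/
lemma IsGeneratorPair.inner_eq {α ℓ : ℝ} (hℓ : 0 < ℓ) {f g f' g' : H ℓ} {w v p w' v' p' : ℝ → ℝ}
    (h : IsGeneratorPair α ℓ f g w v p) (h' : IsGeneratorPair α ℓ f' g' w' v' p') :
    inner ℝ g f' = - ∫ x, x ^ α * v x * v' x ∂mu ℓ := by
  have hae : ∀ᵐ x ∂mu ℓ, x ^ α * v x * v' x = p x * v' x := by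
    filter_upwards [h.flux_ae_eq] with x hx
    rw [← hx]
  have hint : Integrable (fun x => p x * v' x) (mu ℓ) := by
    refine Integrable.mono' (h.energy.add h'.energy) ?_ ?_
    · exact (h.flux_primitive.continuousOn.aestronglyMeasurable measurableSet_Ioo).mul
        h'.primitive.1.aestronglyMeasurable
    · filter_upwards [hae, ae_restrict_mem measurableSet_Ioo] with x hx hxI
      have hpos : 0 ≤ x ^ α := Real.rpow_nonneg hxI.1.le α
      rw [← hx, mul_assoc, norm_mul, Real.norm_of_nonneg hpos, Real.norm_eq_abs]
      simp only [Pi.add_apply]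
      rw [← mul_add]
      refine mul_le_mul_of_nonneg_left (abs_le.2 ⟨?_, ?_⟩) hpos
      · nlinarith [sq_nonneg (v x + v' x), sq_nonneg (v x), sq_nonneg (v' x)]
      · nlinarith [sq_nonneg (v x - v' x), sq_nonneg (v x), sq_nonneg (v' x)]
  have key : ∫ x, g x * w' x ∂mu ℓ = - ∫ x, p x * v' x ∂mu ℓ := by
    refine h.flux_primitive.integral_mul_eq_neg hℓ h'.primitive (Lp.memLp g)
      ((memLp_congr_ae h'.ae_eq).1 (Lp.memLp f')) hint h'.right
      ((lt_or_ge α 1).imp h'.left h.flux_left)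
  rw [integral_congr_ae hae, ← key, L2.inner_def]
  refine integral_congr_ae ?_
  filter_upwards [h'.ae_eq] with x hx
  simp [hx, mul_comm]

/-- Two functions in the domains for different exponents that have the same image and the same
derivative vanish. -/
lemma IsGeneratorPair.eq_zero_of_lt {α β ℓ : ℝ} (hℓ : 0 < ℓ) (hℓ1 : ℓ ≤ 1) (hαβ : α < β)
    {f g : H ℓ} {w v p w' v' p' : ℝ → ℝ} (h : IsGeneratorPair α ℓ f g w v p)
    (h' : IsGeneratorPair β ℓ f g w' v' p') : f = 0 := by
  have hv : v =ᵐ[mu ℓ] v' := h.primitive.ae_eq h'.primitive (h.ae_eq.symm.trans h'.ae_eq)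
  have henergy : Integrable (fun x => x ^ β * v x ^ 2) (mu ℓ) := by
    refine h'.energy.congr ?_
    filter_upwards [hv] with x hx
    rw [hx]
  -- Both energies equal `-⟨g, f⟩`.
  have heq : ∫ x, x ^ α * v x ^ 2 ∂mu ℓ = ∫ x, x ^ β * v x ^ 2 ∂mu ℓ := by
    have e := (h.inner_eq hℓ h).symm.trans (h'.inner_eq hℓ h')
    rw [neg_inj] at e
    calc ∫ x, x ^ α * v x ^ 2 ∂mu ℓ = ∫ x, x ^ α * v x * v x ∂mu ℓ := by
          simp only [sq, mul_assoc]
      _ = ∫ x, x ^ β * v' x * v' x ∂mu ℓ := e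
      _ = ∫ x, x ^ β * v x ^ 2 ∂mu ℓ := by
          refine integral_congr_ae ?_
          filter_upwards [hv] with x hx
          rw [hx]
          ring
  have hlt : ∀ x ∈ Ioo 0 ℓ, 0 < x ^ α - x ^ β := fun x hx =>
    sub_pos.2 (Real.rpow_lt_rpow_of_exponent_gt hx.1 (hx.2.trans_le hℓ1) hαβ)
  have hzero : ∫ x, ((fun x => x ^ α * v x ^ 2) - fun x => x ^ β * v x ^ 2) x ∂mu ℓ = 0 := by
    rw [integral_sub' h.energy henergy, heq, sub_self]
  rw [integral_eq_zero_iff_of_nonneg_ae ?_ (h.energy.sub henergy)] at hzero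
  · have hv0 : ∀ᵐ x ∂mu ℓ, v x = 0 := by
      filter_upwards [hzero, ae_restrict_mem measurableSet_Ioo] with x hx hxI
      have : (x ^ α - x ^ β) * v x ^ 2 = 0 := by
        rw [sub_mul]
        exact hx
      simpa [(hlt x hxI).ne'] using this
    have hw0 : ∀ x ∈ Ioo 0 ℓ, w x = 0 := by
      intro x hx
      have hconst : ∀ y ∈ Ioo 0 ℓ, w y = w x := by
        intro y hy
        have hz : ∫ s in x..y, v s = 0 := by
          refine intervalIntegral.integral_zero_ae ?_
          filter_upwards [(ae_restrict_iff' measurableSet_Ioo).1 hv0] with s hs hsI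
          exact hs (uIcc_subset_Ioo hx hy (uIoc_subset_uIcc hsI))
        linarith [h.primitive.2 x hx y hy]
      refine tendsto_nhds_unique (tendsto_const_nhds.congr' ?_) h.right
      filter_upwards [Ioo_mem_nhdsLT hℓ] with y hy
      exact (hconst y hy).symm
    refine (Lp.eq_zero_iff_ae_eq_zero).2 ?_
    filter_upwards [h.ae_eq, ae_restrict_mem measurableSet_Ioo] with x hx hxI
    rw [hx, hw0 x hxI, Pi.zero_apply]
  · filter_upwards [ae_restrict_mem measurableSet_Ioo] with x hxI
    rw [Pi.sub_apply, ← sub_mul]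
    exact mul_nonneg (hlt x hxI).le (sq_nonneg _)

/-- A common weak derivative makes the difference constant, and the zero traces at `ℓ` make that
constant zero, whatever the exponents. -/
lemma IsGeneratorPair.eq_of_hasWeakDeriv {α β ℓ : ℝ} (hℓ : 0 < ℓ) {f g f' g' : H ℓ}
    {w v p w' v' p' : ℝ → ℝ} (h : IsGeneratorPair α ℓ f g w v p)
    (h' : IsGeneratorPair β ℓ f' g' w' v' p')
    (hd : ∃ z : ℝ → ℝ, HasWeakDeriv ℓ f z ∧ HasWeakDeriv ℓ f' z) : f = f' := by
  obtain ⟨z, ⟨hz, a, hfa, ha⟩, ⟨-, b, hfb, hb⟩⟩ := hd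
  have ha' : IsPrimitiveOn ℓ a z := ⟨hz, ha⟩
  have hb' : IsPrimitiveOn ℓ b z := ⟨hz, hb⟩
  have hlim := (ha'.tendsto_of_hasTrace hfa (Ioo_mem_nhdsLT hℓ)
    ⟨w, h.ae_eq, h.primitive.continuousOn, h.right⟩).sub (hb'.tendsto_of_hasTrace hfb
      (Ioo_mem_nhdsLT hℓ) ⟨w', h'.ae_eq, h'.primitive.continuousOn, h'.right⟩)
  refine Lp.ext ?_
  filter_upwards [hfa, hfb, ae_restrict_mem measurableSet_Ioo] with x hxa hxb hx
  have : a x - b x = 0 - 0 := by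
    refine tendsto_nhds_unique (tendsto_const_nhds.congr' ?_) hlim
    filter_upwards [Ioo_mem_nhdsLT hℓ] with y hy
    linarith [ha x hx y hy, hb x hx y hy]
  rw [hxa, hxb]
  linarith

/-! ### Backward uniqueness and conclusion. -/

/-- Backward uniqueness for `u' = A u` with a symmetric operator `A`: the function
`s ↦ ⟨u (t - s), u (t + s)⟩` is constant. -/
lemma eq_zero_of_symmetric_flow {E : Type*} [NormedAddCommGroup E] [InnerProductSpace ℝ E]
    {T t₀ : ℝ} {u u' : ℝ → E} (hu : ContinuousOn u (Icc 0 T))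
    (hd : ∀ t ∈ Ioc 0 T, HasDerivWithinAt u (u' t) (Icc 0 T) t)
    (hsymm : ∀ s ∈ Ioc 0 T, ∀ t ∈ Ioc 0 T, inner ℝ (u' s) (u t) = inner ℝ (u s) (u' t))
    (ht₀ : t₀ ∈ Ioc 0 T) (h0 : u t₀ = 0) : u 0 = 0 := by
  -- The function `s ↦ ⟨u (t/2 - s), u (t/2 + s)⟩` equals `‖u (t/2)‖²` at `s = 0` and `⟨u 0, u t⟩ =
  -- 0` at `s = t/2`. The latter endpoint needs only continuity, as `u` need not be differentiable
  -- at time `0`.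
  have half : ∀ t ∈ Ioc 0 T, u t = 0 → u (t / 2) = 0 := by
    intro t ht hut
    have hm : ∀ s ∈ Icc 0 (t / 2), t / 2 - s ∈ Icc 0 T ∧ t / 2 + s ∈ Icc 0 T := fun s hs =>
      ⟨⟨by linarith [hs.2], by linarith [hs.1, ht.2, ht.1]⟩,
        ⟨by linarith [hs.1, ht.1], by linarith [hs.2, ht.2]⟩⟩
    have hc : ContinuousOn (fun s => inner ℝ (u (t / 2 - s)) (u (t / 2 + s)))
        (Icc 0 (t / 2)) :=
      (hu.comp (by fun_prop) fun s hs => (hm s hs).1).inner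
        (hu.comp (by fun_prop) fun s hs => (hm s hs).2)
    have hder : ∀ s ∈ Ico 0 (t / 2),
        HasDerivAt (fun s => inner ℝ (u (t / 2 - s)) (u (t / 2 + s))) 0 s := by
      intro s hs
      have m1 : t / 2 - s ∈ Ioo 0 T := ⟨by linarith [hs.2], by linarith [hs.1, ht.2, ht.1]⟩
      have m2 : t / 2 + s ∈ Ioo 0 T := ⟨by linarith [hs.1, ht.1], by linarith [hs.2, ht.2]⟩
      have d1 := (hd _ (Ioo_subset_Ioc_self m1)).hasDerivAt (Icc_mem_nhds m1.1 m1.2)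
      have d2 := (hd _ (Ioo_subset_Ioc_self m2)).hasDerivAt (Icc_mem_nhds m2.1 m2.2)
      have e1 := d1.scomp s ((hasDerivAt_id s).const_sub (t / 2))
      have e2 := d2.scomp s ((hasDerivAt_id s).const_add (t / 2))
      have := e1.inner ℝ e2
      refine this.congr_deriv ?_
      simp only [Function.comp_apply, neg_smul, one_smul, inner_neg_left]
      rw [hsymm _ (Ioo_subset_Ioc_self m1) _ (Ioo_subset_Ioc_self m2)]
      ring
    have htpos : (0 : ℝ) ≤ t / 2 := by linarith [ht.1]
    have hconst := constant_of_has_deriv_right_zero hc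
      (fun s hs => (hder s hs).hasDerivWithinAt) (t / 2) (right_mem_Icc.2 htpos)
    simpa [hut] using hconst.symm
  -- Repeated halving carries the zero of `u` to times tending to `0`, where continuity concludes.
  have hseq : ∀ n : ℕ, t₀ / 2 ^ n ∈ Ioc 0 T ∧ u (t₀ / 2 ^ n) = 0 := by
    intro n
    induction n with
    | zero => simpa using ⟨ht₀, h0⟩
    | succ n ih =>
      rw [pow_succ, ← div_div]
      exact ⟨⟨by linarith [ih.1.1], by linarith [ih.1.1, ih.1.2]⟩, half _ ih.1 ih.2⟩
  have hlim : Tendsto (fun n : ℕ => t₀ / 2 ^ n) atTop (𝓝[Icc 0 T] 0) := by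
    refine tendsto_nhdsWithin_iff.2 ⟨?_, Eventually.of_forall fun n =>
      Ioc_subset_Icc_self (hseq n).1⟩
    have := (tendsto_pow_atTop_nhds_zero_of_lt_one (r := (1 / 2 : ℝ)) (by norm_num)
      (by norm_num)).const_mul t₀
    simpa [div_eq_mul_inv] using this
  have h1 := (hu 0 ⟨le_rfl, ht₀.1.le.trans ht₀.2⟩).tendsto.comp hlim
  refine tendsto_nhds_unique h1 ?_
  refine tendsto_const_nhds.congr fun n => ?_
  exact (hseq n).2.symm

lemma IsSolution.eq_zero_of_eq_zero {α ℓ T t₀ : ℝ} (hℓ : 0 < ℓ) {u₀ : H ℓ} {u : ℝ → H ℓ}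
    (h : IsSolution α ℓ T u₀ u) (ht₀ : t₀ ∈ Ioc 0 T) (h0 : u t₀ = 0) : u₀ = 0 := by
  choose! u' hu' w v p hp using fun t (ht : t ∈ Ioc 0 T) => h.exists_isGeneratorPair hℓ ht
  rw [← h.init]
  refine eq_zero_of_symmetric_flow h.cont hu' (fun s hs t ht => ?_) ht₀ h0
  rw [(hp s hs).inner_eq hℓ (hp t ht), real_inner_comm, (hp t ht).inner_eq hℓ (hp s hs)]
  simp only [mul_assoc, mul_comm (v s _)]

end DegenerateParabolic

theorem mainTheorem5 (ℓ T : ℝ) (hℓ0 : 0 < ℓ) (hℓ1 : ℓ ≤ 1)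
    (α₁ α₂ : ℝ) (hα₁ : α₁ ∈ Set.Ico (0 : ℝ) 2) (hα₂ : α₂ ∈ Set.Ico (0 : ℝ) 2)
    (u₀ : DegenerateParabolic.H ℓ) (hu₀ : u₀ ≠ 0)
    (u₁ u₂ : ℝ → DegenerateParabolic.H ℓ)
    (hu₁ : DegenerateParabolic.IsSolution α₁ ℓ T u₀ u₁)
    (hu₂ : DegenerateParabolic.IsSolution α₂ ℓ T u₀ u₂)
    (t₀ : ℝ) (ht₀ : t₀ ∈ Set.Ioc 0 T)
    (hdt : derivWithin u₁ (Set.Icc 0 T) t₀ = derivWithin u₂ (Set.Icc 0 T) t₀)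
    (hdx : ∃ v : ℝ → ℝ, DegenerateParabolic.HasWeakDeriv ℓ (u₁ t₀) v ∧
      DegenerateParabolic.HasWeakDeriv ℓ (u₂ t₀) v) :
    α₁ = α₂ := by
  obtain ⟨g₁, hg₁, w₁, v₁, p₁, h₁⟩ := hu₁.exists_isGeneratorPair hℓ0 ht₀
  obtain ⟨g₂, hg₂, w₂, v₂, p₂, h₂⟩ := hu₂.exists_isGeneratorPair hℓ0 ht₀
  have hun : UniqueDiffWithinAt ℝ (Icc 0 T) t₀ :=
    uniqueDiffOn_Icc (ht₀.1.trans_le ht₀.2) t₀ (Ioc_subset_Icc_self ht₀)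
  rw [hg₁.derivWithin hun, hg₂.derivWithin hun] at hdt
  have hu := h₁.eq_of_hasWeakDeriv hℓ0 h₂ hdx
  -- Now `h₁` and `h₂` concern the same function and the same image, with different exponents only.
  rw [← hdt, ← hu] at h₂
  rcases lt_trichotomy α₁ α₂ with hlt | heq | hlt
  · exact absurd (hu₁.eq_zero_of_eq_zero hℓ0 ht₀ (h₁.eq_zero_of_lt hℓ0 hℓ1 hlt h₂)) hu₀
  · exact heq
  · exact absurd (hu₁.eq_zero_of_eq_zero hℓ0 ht₀ (h₂.eq_zero_of_lt hℓ0 hℓ1 hlt h₁)) hu₀
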